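/- All operators are bounded linear maps on complex Hilbert spaces. Let $\mathbb D,\mathbb T$ be the open unit disc and the unit circle, $\mathbb E=\{z\in\mathbb C:|z|>1\}$, $\pi(z_1,z_2)=(z_1+z_2,z_1z_2)$, $\mathbb G_2=\pi(\mathbb D^2)$ and $b\Gamma=\pi(\mathbb T^2)$. A *$\Gamma$-unitary* is a commuting pair of normal operators whose Taylor joint spectrum is contained in $b\Gamma$. A *$\Gamma$-isometry* on a Hilbert space $\mathcal H$ is a commuting pair $(S,P)$ of operators on $\mathcal H$ for which there are a Hilbert space $\mathcal K\supseteq\mathcal H$ and a $\Gamma$-unitary $(\widetilde T,\widetilde U)$ on $\mathcal K$ leaving $\mathcal H$ invariant such that $(S,P)=(\widetilde T|_{\mathcal H},\widetilde U|_{\mathcal H})$; it is *pure* if $P^{*n}\to0$ strongly as $n\to\infty$. A polynomial $q\in\mathbb C[z_1,z_2]$ is *distinguished* if its zero set satisfies $Z(q)\subseteq\mathbb G_2\cup b\Gamma\cup\pi(\mathbb E^2)$. For $\Sigma=(T,V)$ write $q(\Sigma)=q(T,V)$; $q$ *annihilates* $\Sigma$ if $q(\Sigma)=0$. **Theorem.**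 Let $\Sigma=(T,V)$ be a pure $\Gamma$-isometry on a Hilbert space $\mathcal H$, let $q\in\mathbb C[z_1,z_2]$ be a distinguished polynomial that annihilates $\Sigma$, let $q_1,\dots,q_N$ be the distinct irreducible factors of $q$ (up to nonzero constants; multiplicities in $q$ are allowed), and let $r_j=q/q_j$ for $1\le j\le N$. Then there are closed subspaces $\mathcal H_1,\dots,\mathcal H_N$ and $\mathcal H'$ of $\mathcal H$, mutually orthogonal, such that $$\mathcal H=\mathcal H_1\oplus\cdots\oplus\mathcal H_N\oplus\mathcal H',\qquad \mathcal H'=\mathcal H\ominus(\mathcal H_1\oplus\cdots\oplus\mathcal H_N),$$ and such that for each $j=1,\dots,N$: $\mathcal H_j=\overline{r_j(\Sigma)\mathcal H}$; $\mathcal H_j$ is invariant under both $T$ and $V$; and $\Sigma|_{\mathcal H_j}=(T|_{\mathcal H_j},V|_{\mathcal H_j})$ is a pure $\Gamma$-isometry annihilated by $q_j$. -/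

import Mathlib

open Filter Topology

noncomputable section

namespace SymBidisc

universe u

/-- The symmetrization map `π (z₁, z₂) = (z₁ + z₂, z₁ z₂)`. -/
def symm (z : ℂ × ℂ) : ℂ × ℂ := (z.1 + z.2, z.1 * z.2)

/-- The open symmetrized bidisc `𝔾₂ = π(𝔻²)`. -/
def G2 : Set (ℂ × ℂ) := symm '' {z | ‖z.1‖ < 1 ∧ ‖z.2‖ < 1}

/-- The distinguished boundary `bΓ = π(𝕋²)` of the closed symmetrized bidisc `Γ`. -/
def bGamma : Set (ℂ × ℂ) := symm '' {z | ‖z.1‖ = 1 ∧ ‖z.2‖ = 1}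

/-- The set `π(𝔼²)`, where `𝔼` is the complement of the closed unit disc. -/
def symmExterior : Set (ℂ × ℂ) := symm '' {z | 1 < ‖z.1‖ ∧ 1 < ‖z.2‖}

/-- The zero set `Z(q)` in `ℂ²` of a polynomial in two variables. -/
def zeroSet (q : MvPolynomial (Fin 2) ℂ) : Set (ℂ × ℂ) :=
  {z | MvPolynomial.eval ![z.1, z.2] q = 0}

/-- A polynomial is distinguished if `Z(q) ⊆ 𝔾₂ ∪ bΓ ∪ π(𝔼²)`. -/
def IsDistinguished (q : MvPolynomial (Fin 2) ℂ) : Prop :=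
  zeroSet q ⊆ G2 ∪ bGamma ∪ symmExterior

section Operators

variable {E : Type*} [NormedAddCommGroup E] [InnerProductSpace ℂ E]

/-- The operator `q(A, B)`: the monomial `z₁ᵃ z₂ᵇ` is evaluated as `Aᵃ Bᵇ`. -/
def polyEval (q : MvPolynomial (Fin 2) ℂ) (A B : E →L[ℂ] E) : E →L[ℂ] E :=
  ∑ m ∈ q.support, q.coeff m • (A ^ m 0 * B ^ m 1)

/-- The first map `x ↦ (A x, B x)` of the Koszul complex `0 → E → E × E → E → 0` of `(A, B)`. -/
def koszul₀ (A B : E →L[ℂ] E) (x : E) : E × E := (A x, B x)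

/-- The second map `(x, y) ↦ A y - B x` of the Koszul complex of `(A, B)`. -/
def koszul₁ (A B : E →L[ℂ] E) (v : E × E) : E := A v.2 - B v.1

/-- Exactness of the Koszul complex of a pair of operators. -/
def KoszulExact (A B : E →L[ℂ] E) : Prop :=
  Function.Injective (koszul₀ A B) ∧ Function.Exact (koszul₀ A B) (koszul₁ A B) ∧
    Function.Surjective (koszul₁ A B)

/-- The Taylor joint spectrum of a (commuting) pair of operators: all `(z₁, z₂)` for which the
Koszul complex of `(A - z₁, B - z₂)` is not exact. -/
def taylorSpectrum (A B : E →L[ℂ] E) : Set (ℂ × ℂ) :=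
  {z | ¬ KoszulExact (A - z.1 • (1 : E →L[ℂ] E)) (B - z.2 • (1 : E →L[ℂ] E))}

/-- A `Γ`-unitary: a commuting pair of normal operators on a Hilbert space whose Taylor joint
spectrum is contained in `bΓ`. -/
structure IsGammaUnitary [CompleteSpace E] (S P : E →L[ℂ] E) : Prop where
  commute : Commute S P
  normal_left : IsStarNormal S
  normal_right : IsStarNormal P
  spectrum_subset : taylorSpectrum S P ⊆ bGamma

end Operators

/-- A `Γ`-isometry: a commuting pair that is the restriction of a `Γ`-unitary `(T, U)` on a Hilbert
space `K ⊇ H` to the common invariant subspace `H`. The inclusion `H ⊆ K` is the linear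
isometry `J`. -/
def IsGammaIsometry {H : Type u} [NormedAddCommGroup H] [InnerProductSpace ℂ H]
    (S P : H →L[ℂ] H) : Prop :=
  Commute S P ∧
    ∃ (K : Type u) (_ : NormedAddCommGroup K) (_ : InnerProductSpace ℂ K) (_ : CompleteSpace K)
      (J : H →ₗᵢ[ℂ] K) (T U : K →L[ℂ] K),
      IsGammaUnitary T U ∧ (∀ x, J (S x) = T (J x)) ∧ (∀ x, J (P x) = U (J x))

/-- A pure `Γ`-isometry: a `Γ`-isometry `(S, P)` with `(P*)ⁿ → 0` strongly. -/
structure IsPureGammaIsometry {H : Type*} [NormedAddCommGroup H] [InnerProductSpace ℂ H]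
    [CompleteSpace H] (S P : H →L[ℂ] H) : Prop where
  isGammaIsometry : IsGammaIsometry S P
  pure : ∀ x : H, Tendsto (fun n : ℕ => (ContinuousLinearMap.adjoint P ^ n) x) atTop (𝓝 0)

/-- `q₁, …, q_N` is a list of the distinct irreducible factors of `q`, each up to a nonzero
constant; multiplicities in `q` are allowed. -/
structure AreDistinctIrredFactors {N : ℕ} (q : MvPolynomial (Fin 2) ℂ)
    (qf : Fin N → MvPolynomial (Fin 2) ℂ) : Prop where
  irreducible : ∀ j, Irreducible (qf j)
  dvd : ∀ j, qf j ∣ q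
  distinct : ∀ i j, i ≠ j → ¬ Associated (qf i) (qf j)
  exhaustive : ∀ p, Irreducible p → p ∣ q → ∃ j, Associated p (qf j)

/-- `H` is the orthogonal direct sum of the finitely many closed subspaces `L i`. -/
structure IsOrthogonalSum {H : Type*} [NormedAddCommGroup H] [InnerProductSpace ℂ H]
    {ι : Type*} [Fintype ι] [DecidableEq ι] (L : ι → Submodule ℂ H) : Prop where
  isClosed : ∀ i, IsClosed (L i : Set H)
  orthogonal : ∀ i j, i ≠ j → L i ⟂ L j
  isInternal : DirectSum.IsInternal L

end SymBidisc

end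

/-! A polynomial in the extending Γ-unitary is normal (Fuglede), so it and its adjoint have the same
kernel. Hence `p(Σ)` and `q(Σ)` have orthogonal ranges whenever `pq` annihilates `Σ`
(`inner_polyEval_eq_zero`). For `i ≠ j`, `q` divides `r i * r j`
(`AreDistinctIrredFactors.dvd_mul`), so the closed ranges of the `r j(Σ)` are mutually orthogonal;
`qf j` kills the `j`-th because `qf j * r j = q`. -/

namespace SymBidisc

section PolyEval

variable {E : Type*} [NormedAddCommGroup E] [InnerProductSpace ℂ E]

/-- For commuting `A`, `B`, the map `m ↦ A ^ m 0 * B ^ m 1` as a monoid homomorphism. -/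
def monomialHom {A B : E →L[ℂ] E} (h : Commute A B) :
    Multiplicative (Fin 2 →₀ ℕ) →* (E →L[ℂ] E) where
  toFun m := A ^ m.toAdd 0 * B ^ m.toAdd 1
  map_one' := by simp
  map_mul' m n := by
    simp only [toAdd_mul, Finsupp.add_apply, pow_add]
    rw [mul_assoc, mul_assoc, ← mul_assoc (A ^ n.toAdd 0),
      ((h.pow_pow (n.toAdd 0) (m.toAdd 1))).eq, mul_assoc]

/-- The operator algebra is noncommutative, so multiplicativity of `polyEval` comes from this lift
rather than from `MvPolynomial.aeval`. -/
theorem polyEval_eq_lift {A B : E →L[ℂ] E} (h : Commute A B) (p : MvPolynomial (Fin 2) ℂ) :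
    polyEval p A B = AddMonoidAlgebra.lift ℂ (E →L[ℂ] E) (Fin 2 →₀ ℕ) (monomialHom h) p := by
  rw [AddMonoidAlgebra.lift_apply]
  rfl

theorem polyEval_mul {A B : E →L[ℂ] E} (h : Commute A B) (p q : MvPolynomial (Fin 2) ℂ) :
    polyEval (p * q) A B = polyEval p A B * polyEval q A B := by
  simp only [polyEval_eq_lift h]
  exact map_mul _ p q

theorem commute_polyEval {X A B : E →L[ℂ] E} (hA : Commute X A) (hB : Commute X B)
    (p : MvPolynomial (Fin 2) ℂ) : Commute X (polyEval p A B) :=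
  Commute.sum_right _ _ _ fun m _ =>
    ((hA.pow_right (m 0)).mul_right (hB.pow_right (m 1))).smul_right (p.coeff m)

/-- Serves both for the embedding into the Γ-unitary's space and for the inclusion of an invariant
subspace. -/
theorem map_polyEval {F : Type*} [NormedAddCommGroup F] [InnerProductSpace ℂ F]
    {S P : E →L[ℂ] E} {T U : F →L[ℂ] F} (J : E →ₗᵢ[ℂ] F) (hS : ∀ x, J (S x) = T (J x))
    (hP : ∀ x, J (P x) = U (J x)) (p : MvPolynomial (Fin 2) ℂ) (x : E) :
    J (polyEval p S P x) = polyEval p T U (J x) := by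
  have hS' (n : ℕ) : Function.Semiconj J S^[n] T^[n] := Function.Semiconj.iterate_right hS n
  have hP' (n : ℕ) : Function.Semiconj J P^[n] U^[n] := Function.Semiconj.iterate_right hP n
  simp [polyEval, (hS' _).eq, (hP' _).eq]

/-- A polynomial in two commuting normal operators is normal, by Fuglede's theorem. -/
theorem isStarNormal_polyEval [CompleteSpace E] {A B : E →L[ℂ] E} (h : Commute A B)
    (hA : IsStarNormal A) (hB : IsStarNormal B) (p : MvPolynomial (Fin 2) ℂ) :
    IsStarNormal (polyEval p A B) := by
  have hAB : Commute (star A) B := (hA.commute_star_right h.symm).symm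
  have hBA : Commute (star B) A := (hB.commute_star_right h).symm
  have h₁ : Commute (star (polyEval p A B)) A := by
    simpa using (commute_polyEval hA.star_comm_self hAB p).star_star.symm
  have h₂ : Commute (star (polyEval p A B)) B := by
    simpa using (commute_polyEval hBA hB.star_comm_self p).star_star.symm
  exact ⟨commute_polyEval h₁ h₂ p⟩

end PolyEval

section Subnormal

universe u

variable {H : Type u} [NormedAddCommGroup H] [InnerProductSpace ℂ H]

/-- If the product of two polynomials annihilates a `Γ`-isometry, then the ranges of the two
polynomials are orthogonal. -/
theorem IsGammaIsometry.inner_polyEval_eq_zero {S P : H →L[ℂ] H} (h : IsGammaIsometry S P)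
    {p q : MvPolynomial (Fin 2) ℂ} (hpq : polyEval (p * q) S P = 0) (x y : H) :
    inner ℂ (polyEval p S P x) (polyEval q S P y) = 0 := by
  obtain ⟨-, K, _, _, _, J, T, U, hTU, hS, hP⟩ := h
  have hn := isStarNormal_polyEval hTU.commute hTU.normal_left hTU.normal_right p
  have h0 : polyEval p T U (polyEval q T U (J y)) = 0 := by
    rw [← mul_apply_eq_comp, ← polyEval_mul hTU.commute, ← map_polyEval J hS hP, hpq]
    simp
  -- A normal operator satisfies `‖N z‖ = ‖N* z‖`.
  have h1 : ContinuousLinearMap.adjoint (polyEval p T U) (polyEval q T U (J y)) = 0 := by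
    rw [← norm_eq_zero,
      ← ContinuousLinearMap.isStarNormal_iff_norm_eq_adjoint.mp hn, h0, norm_zero]
  rw [← J.inner_map_map, map_polyEval J hS hP, map_polyEval J hS hP,
    ← ContinuousLinearMap.adjoint_inner_right, h1, inner_zero_right]

theorem IsGammaIsometry.restrict {S P : H →L[ℂ] H} (h : IsGammaIsometry S P)
    {L : Submodule ℂ H} (hS : ∀ x ∈ L, S x ∈ L) (hP : ∀ x ∈ L, P x ∈ L) :
    IsGammaIsometry (S.restrict hS) (P.restrict hP) := by
  obtain ⟨hc, K, _, _, _, J, T, U, hTU, hJS, hJP⟩ := h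
  refine ⟨?_, K, _, _, _, J.comp L.subtypeₗᵢ, T, U, hTU, fun x => hJS x, fun x => hJP x⟩
  ext x
  exact congrArg (fun A : H →L[ℂ] H => A x) hc.eq

/-- With `ι` the inclusion of `L`, taking adjoints in `P ι = ι P|_L` gives `(P|_L)*ⁿ ι* = ι* P*ⁿ`,
and `ι* x = x` on `L`. -/
theorem IsPureGammaIsometry.restrict [CompleteSpace H] {S P : H →L[ℂ] H}
    (h : IsPureGammaIsometry S P) {L : Submodule ℂ H} [CompleteSpace L]
    (hS : ∀ x ∈ L, S x ∈ L) (hP : ∀ x ∈ L, P x ∈ L) :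
    IsPureGammaIsometry (S.restrict hS) (P.restrict hP) := by
  refine ⟨h.isGammaIsometry.restrict hS hP, fun x => ?_⟩
  have hcomm : ∀ y : H, ContinuousLinearMap.adjoint L.subtypeL (ContinuousLinearMap.adjoint P y) =
      ContinuousLinearMap.adjoint (P.restrict hP) (ContinuousLinearMap.adjoint L.subtypeL y) := by
    intro y
    rw [← ContinuousLinearMap.comp_apply, ← ContinuousLinearMap.comp_apply,
      ← ContinuousLinearMap.adjoint_comp, ← ContinuousLinearMap.adjoint_comp]
    rfl
  have hpow : ∀ (n : ℕ) (y : H),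
      ContinuousLinearMap.adjoint L.subtypeL ((ContinuousLinearMap.adjoint P ^ n) y) =
      (ContinuousLinearMap.adjoint (P.restrict hP) ^ n)
        (ContinuousLinearMap.adjoint L.subtypeL y) := by
    intro n
    induction n with
    | zero => simp
    | succ n ih => intro y; simp only [pow_succ, mul_apply_eq_comp, ih, hcomm]
  have hx : ContinuousLinearMap.adjoint L.subtypeL (x : H) = x := by
    rw [Submodule.adjoint_subtypeL]
    simp
  have := ((ContinuousLinearMap.adjoint L.subtypeL).continuous.tendsto 0).comp (h.pure x)
  simpa only [Function.comp_def, hpow, hx, map_zero] using this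

end Subnormal

/-- Distinct irreducible factors: `q` divides the product of two different cofactors. -/
theorem AreDistinctIrredFactors.dvd_mul {N : ℕ} {q : MvPolynomial (Fin 2) ℂ}
    {qf r : Fin N → MvPolynomial (Fin 2) ℂ} (hqf : AreDistinctIrredFactors q qf)
    (hr : ∀ j, q = qf j * r j) {i j : Fin N} (hij : i ≠ j) : q ∣ r i * r j := by
  have hdvd : qf j ∣ qf i * r i := hr i ▸ hqf.dvd j
  -- Irreducibles are prime here, so `qf j` must divide `r i`.
  rcases (hqf.irreducible j).prime.dvd_or_dvd hdvd with h | h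
  · exact absurd ((hqf.irreducible j).associated_of_dvd (hqf.irreducible i) h)
      (hqf.distinct j i hij.symm)
  · rw [hr j]
    exact mul_dvd_mul_right h (r j)

/-- Finitely many pairwise orthogonal closed subspaces, together with the orthogonal complement of
their span, form an orthogonal decomposition. -/
theorem isOrthogonalSum_option {H : Type*} [NormedAddCommGroup H] [InnerProductSpace ℂ H]
    {ι : Type*} [Fintype ι] [DecidableEq ι] (L : ι → Submodule ℂ H) [∀ i, CompleteSpace (L i)]
    (hL : ∀ i j, i ≠ j → L i ⟂ L j) :
    IsOrthogonalSum (fun i : Option ι => i.elim (⨆ j, L j)ᗮ L) := by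
  have horth : ∀ i j : Option ι, i ≠ j →
      (i.elim (⨆ j, L j)ᗮ L : Submodule ℂ H) ⟂ j.elim (⨆ j, L j)ᗮ L := by
    rintro (_ | i) (_ | j) hij
    · exact absurd rfl hij
    · exact ((Submodule.isOrtho_orthogonal_right _).mono_left (le_iSup L j)).symm
    · exact (Submodule.isOrtho_orthogonal_right _).mono_left (le_iSup L i)
    · exact hL i j fun h => hij (congrArg some h)
  refine ⟨?_, horth, ?_⟩
  · rintro (_ | i)
    · exact Submodule.isClosed_orthogonal _
    · exact (completeSpace_coe_iff_isComplete.mp inferInstance : IsComplete (L i : Set H)).isClosed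
  · rw [DirectSum.isInternal_submodule_iff_iSupIndep_and_iSup_eq_top]
    refine ⟨(OrthogonalFamily.of_pairwise fun i j hij => horth i j hij).independent, ?_⟩
    rw [iSup_option, eq_top_iff]
    intro x _
    have hmem : ∑ j, (L j).starProjection x ∈ ⨆ j, L j :=
      Submodule.sum_mem _ fun j _ =>
        Submodule.mem_iSup_of_mem j (Submodule.starProjection_apply_mem _ _)
    rw [← sub_add_cancel x (∑ j, (L j).starProjection x)]
    refine Submodule.add_mem_sup ?_ hmem
    change _ ∈ (⨆ j, L j)ᗮ
    rw [← Submodule.iInf_orthogonal, Submodule.mem_iInf]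
    intro i
    -- Both `x` minus its projection to `L i` and the projections to the other `L j` are orthogonal
    -- to `L i`.
    rw [← Finset.add_sum_erase _ _ (Finset.mem_univ i), ← sub_sub]
    refine Submodule.sub_mem _ (Submodule.sub_starProjection_mem_orthogonal x)
      (Submodule.sum_mem _ fun j hj => ?_)
    exact hL j i (Finset.ne_of_mem_erase hj) (Submodule.starProjection_apply_mem _ _)

end SymBidisc

theorem theorem8p4 {H : Type*} [NormedAddCommGroup H] [InnerProductSpace ℂ H] [CompleteSpace H]
    (T V : H →L[ℂ] H) (hTV : SymBidisc.IsPureGammaIsometry T V)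
    (q : MvPolynomial (Fin 2) ℂ) (hq : SymBidisc.IsDistinguished q)
    (hann : SymBidisc.polyEval q T V = 0)
    (N : ℕ) (qf r : Fin N → MvPolynomial (Fin 2) ℂ)
    (hqf : SymBidisc.AreDistinctIrredFactors q qf)
    (hr : ∀ j, q = qf j * r j) :
    ∃ (L : Fin N → Submodule ℂ H) (L' : Submodule ℂ H),
      SymBidisc.IsOrthogonalSum (fun i : Option (Fin N) => i.elim L' L) ∧
      L' = (⨆ j, L j)ᗮ ∧
      (∀ j, L j = (SymBidisc.polyEval (r j) T V).range.topologicalClosure) ∧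
      ∀ j, ∃ (_ : CompleteSpace (L j)) (hT : ∀ x ∈ L j, T x ∈ L j) (hV : ∀ x ∈ L j, V x ∈ L j),
        SymBidisc.IsPureGammaIsometry (T.restrict hT) (V.restrict hV) ∧
        SymBidisc.polyEval (qf j) (T.restrict hT) (V.restrict hV) = 0 := by
  have hc : Commute T V := hTV.isGammaIsometry.1
  set L : Fin N → Submodule ℂ H :=
    fun j => (SymBidisc.polyEval (r j) T V).range.topologicalClosure with hL
  have hcomplete : ∀ j, CompleteSpace (L j) := fun j =>
    (Submodule.isClosed_topologicalClosure _).completeSpace_coe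
  have horth : ∀ i j, i ≠ j → L i ⟂ L j := by
    intro i j hij
    obtain ⟨s, hs⟩ := hqf.dvd_mul hr hij
    have h0 : SymBidisc.polyEval (r i * r j) T V = 0 := by
      rw [hs, SymBidisc.polyEval_mul hc, hann, zero_mul]
    have hrange : (SymBidisc.polyEval (r i) T V).range ⟂ (SymBidisc.polyEval (r j) T V).range := by
      rw [Submodule.isOrtho_iff_inner_eq]
      rintro _ ⟨x, rfl⟩ _ ⟨y, rfl⟩
      exact hTV.isGammaIsometry.inner_polyEval_eq_zero h0 x y
    -- Orthogonal complements are closed, so orthogonality passes to the closures one side at a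
    -- time.
    have h₁ : L i ⟂ (SymBidisc.polyEval (r j) T V).range :=
      Submodule.topologicalClosure_minimal _ hrange (Submodule.isClosed_orthogonal _)
    have h₂ : L j ⟂ L i :=
      Submodule.topologicalClosure_minimal _ h₁.symm (Submodule.isClosed_orthogonal _)
    exact h₂.symm
  have hinv : ∀ (A : H →L[ℂ] H), Commute A T → Commute A V → ∀ j, ∀ x ∈ L j, A x ∈ L j := by
    intro A hAT hAV j x hx
    refine map_mem_closure A.continuous hx ?_
    rintro _ ⟨y, rfl⟩
    exact ⟨A y, (congrArg (fun B : H →L[ℂ] H => B y)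
      (SymBidisc.commute_polyEval hAT hAV (r j)).eq).symm⟩
  refine ⟨L, (⨆ j, L j)ᗮ, SymBidisc.isOrthogonalSum_option L horth, rfl, fun _ => rfl, fun j => ?_⟩
  have hT := hinv T (Commute.refl T) hc j
  have hV := hinv V hc.symm (Commute.refl V) j
  refine ⟨hcomplete j, hT, hV, hTV.restrict hT hV, ?_⟩
  -- `qf j(Σ)` vanishes on the range of `r j(Σ)`, hence on its closure.
  have hker : L j ≤ (SymBidisc.polyEval (qf j) T V).ker := by
    refine Submodule.topologicalClosure_minimal _ ?_ (SymBidisc.polyEval (qf j) T V).isClosed_ker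
    rintro _ ⟨y, rfl⟩
    change (SymBidisc.polyEval (qf j) T V * SymBidisc.polyEval (r j) T V) y = 0
    rw [← SymBidisc.polyEval_mul hc, ← hr j, hann]
    rfl
  ext x
  have := SymBidisc.map_polyEval (S := T.restrict hT) (P := V.restrict hV) (L j).subtypeₗᵢ
    (fun _ => rfl) (fun _ => rfl) (qf j) x
  exact this.trans (hker x.2)
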